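/- Let $p$ be a prime, let $\mathbb F$ be an algebraic closure of $\mathbb F_p$, and let $$K=\bigcup_{N\ge1}\mathbb F((t^{1/N}))\ \subset\ H=\mathbb F((t^{\mathbb Q}))$$ be the field of Newton–Puiseux series and the Hahn field of generalized power series with well-ordered support, with valuation $v(x)=\min(\operatorname{supp}(x))$, $v(0)=\infty$. Let $\overline K$ be the algebraic closure of $K$ in $H$, and for $b\in\overline K$ let $\deg_K b$ be the degree of the minimal polynomial of $b$ over $K$. For $m,n\ge 0$ put $$s_m=\sum_{j\ge m}\binom jm t^{-1/p^{j+1}}\in H,\qquad s_{n,n}=\sum_{m=0}^{n-1}t^m s_m\in H .$$ For $a\in\overline K$ and $\delta\in\mathbb Q$ let $B_\delta(a)=\{b\in\overline K\mid v(b-a)\ge\delta\}$ and $\deg_K B_\delta(a)=\min\{\deg_K b\mid b\in B_\delta(a)\}$. Then for every $n\ge1$ one has $s_{n,n}\in\overline K$, every element of $B_{n-1}(s_{n,n})$ has degree at least $p^n$ over $K$, and $$\deg_K B_{n-1}(s_{n,n})=p^n .$$ -/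

import Mathlib

noncomputable section

namespace HahnTower

/-- The Hahn field `H = F((t^ℚ))` of generalized power series with well-ordered support. -/
abbrev Hahn (F : Type*) [Field F] : Type _ := HahnSeries ℚ F

/-- The map `ℤ → ℚ`, `k ↦ k / N`. -/
def divHom (N : ℕ+) : ℤ →+ ℚ where
  toFun k := (k : ℚ) / ((N : ℕ) : ℚ)
  map_zero' := by simp
  map_add' a b := by push_cast; ring

theorem divHom_apply (N : ℕ+) (k : ℤ) : divHom N k = (k : ℚ) / ((N : ℕ) : ℚ) := rfl

theorem divHom_le (N : ℕ+) (a b : ℤ) : divHom N a ≤ divHom N b ↔ a ≤ b := by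
  have hN : (0 : ℚ) < ((N : ℕ) : ℚ) := by exact_mod_cast N.pos
  rw [divHom_apply, divHom_apply, div_le_div_iff_of_pos_right hN]
  exact_mod_cast Iff.rfl

theorem divHom_injective (N : ℕ+) : Function.Injective (divHom N) := fun a b h =>
  le_antisymm ((divHom_le N a b).1 h.le) ((divHom_le N b a).1 h.ge)

/-- The embedding `F((t)) → H`, `t ↦ t^{1/N}`. -/
def laurentEmb (F : Type*) [Field F] (N : ℕ+) : LaurentSeries F →+* Hahn F :=
  HahnSeries.embDomainRingHom (divHom N) (divHom_injective N) (divHom_le N)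

/-- The subfield `F((t^{1/N}))` of `H`. -/
def laurentRoot (F : Type*) [Field F] (N : ℕ+) : Subfield (Hahn F) :=
  (laurentEmb F N).fieldRange

theorem mem_laurentRoot {F : Type*} [Field F] {N : ℕ+} {x : Hahn F} :
    x ∈ laurentRoot F N ↔ ∀ q ∈ x.support, ∃ k : ℤ, q = (k : ℚ) / ((N : ℕ) : ℚ) := by
  constructor
  · rintro ⟨y, rfl⟩ q hq
    obtain ⟨k, -, rfl⟩ := HahnSeries.support_embDomain_subset hq
    exact ⟨k, rfl⟩
  · intro h
    let f : ℤ ↪o ℚ := ⟨⟨divHom N, divHom_injective N⟩, divHom_le N _ _⟩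
    have hpwo : (Function.support fun k : ℤ => x.coeff (divHom N k)).IsPWO := by
      have hx : x.support.IsWF := x.isPWO_support.isWF
      refine Set.IsWF.isPWO ?_
      rw [Set.isWF_iff_no_descending_seq]
      intro u hu hmem
      exact Set.isWF_iff_no_descending_seq.1 hx (fun n => f (u n))
        (fun a b hab => f.strictMono (hu hab)) hmem
    refine ⟨⟨fun k => x.coeff (divHom N k), hpwo⟩, ?_⟩
    ext q
    by_cases hq : ∃ k : ℤ, q = divHom N k
    · obtain ⟨k, rfl⟩ := hq
      exact HahnSeries.embDomain_coeff (f := f)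
    · have h0 : x.coeff q = 0 := by
        by_contra hne
        exact hq (h q hne)
      rw [h0]
      refine HahnSeries.embDomain_of_notMem_range (f := f) ?_
      rintro ⟨k, hk⟩
      exact hq ⟨k, hk.symm⟩

theorem laurentRoot_le_mul {F : Type*} [Field F] (N M : ℕ+) :
    laurentRoot F N ≤ laurentRoot F (N * M) := by
  intro x hx
  rw [mem_laurentRoot] at hx ⊢
  intro q hq
  obtain ⟨k, rfl⟩ := hx q hq
  refine ⟨k * (M : ℕ), ?_⟩
  have hN : ((N : ℕ) : ℚ) ≠ 0 := by exact_mod_cast N.ne_zero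
  have hM : ((M : ℕ) : ℚ) ≠ 0 := by exact_mod_cast M.ne_zero
  push_cast
  field_simp

theorem exists_common {F : Type*} [Field F] {x y : Hahn F}
    (hx : ∃ N, x ∈ laurentRoot F N) (hy : ∃ N, y ∈ laurentRoot F N) :
    ∃ N, x ∈ laurentRoot F N ∧ y ∈ laurentRoot F N := by
  obtain ⟨N, hN⟩ := hx
  obtain ⟨M, hM⟩ := hy
  exact ⟨N * M, laurentRoot_le_mul N M hN, by rw [mul_comm]; exact laurentRoot_le_mul M N hM⟩

/-- The Newton-Puiseux field `K = ⋃_{N ≥ 1} F((t^{1/N}))`, as a subfield of `H`. -/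
def Puiseux (F : Type*) [Field F] : Subfield (Hahn F) where
  carrier := {x | ∃ N : ℕ+, x ∈ laurentRoot F N}
  zero_mem' := ⟨1, zero_mem _⟩
  one_mem' := ⟨1, one_mem _⟩
  add_mem' hx hy := (exists_common hx hy).imp fun _ h => add_mem h.1 h.2
  mul_mem' hx hy := (exists_common hx hy).imp fun _ h => mul_mem h.1 h.2
  neg_mem' hx := hx.imp fun _ h => neg_mem h
  inv_mem' _ hx := hx.imp fun _ h => inv_mem h

/-- The algebraic closure of `K` inside `H`. -/
def Kbar (F : Type*) [Field F] : IntermediateField (Puiseux F) (Hahn F) :=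
  algebraicClosure (Puiseux F) (Hahn F)

/-- The valuation `v(x) = min (supp x)` on `H`, with `v(0) = ∞`. -/
def v {F : Type*} [Field F] (x : Hahn F) : WithTop ℚ := x.orderTop

/-- The degree of `b` over `K`, that is, the degree of its minimal polynomial. -/
def deg {F : Type*} [Field F] (b : Hahn F) : ℕ := (minpoly (Puiseux F) b).natDegree

/-- The ball `B_δ(a) = {b ∈ Kbar | v (b - a) ≥ δ}`. -/
def ball {F : Type*} [Field F] (δ : ℚ) (a : Hahn F) : Set (Hahn F) :=
  {b | b ∈ Kbar F ∧ (δ : WithTop ℚ) ≤ v (b - a)}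

/-- The degree over `K` of a set `B`: the minimal degree of its elements. -/
def degSet {F : Type*} [Field F] (B : Set (Hahn F)) : ℕ := sInf (deg '' B)

/-- The strictly increasing sequence of exponents `j ↦ -1 / p ^ (j + 1)`. -/
def expo (p : ℕ) [hp : Fact p.Prime] : ℕ ↪o ℚ :=
  OrderEmbedding.ofStrictMono (fun j => -1 / (p : ℚ) ^ (j + 1)) <| by
    intro a b hab
    have h1 : (1 : ℚ) < p := by exact_mod_cast hp.out.one_lt
    have h0 : (0 : ℚ) < (p : ℚ) ^ (a + 1) := by positivity
    have h2 : (p : ℚ) ^ (a + 1) < (p : ℚ) ^ (b + 1) := pow_lt_pow_right₀ h1 (by omega)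
    have h3 := one_div_lt_one_div_of_lt h0 h2
    simp only [neg_div]
    linarith

/-- The series `s_n = ∑_{j ≥ n} (j choose n) t ^ (-1 / p ^ (j + 1))` of `H`
(the binomial coefficient vanishes for `j < n`). -/
def s (p : ℕ) [Fact p.Prime] (F : Type*) [Field F] (n : ℕ) : Hahn F :=
  HahnSeries.embDomain (expo p) ⟨fun j => (j.choose n : F), Set.IsWF.isPWO (Set.IsWF.of_wellFoundedLT _)⟩

theorem s_coeff (p : ℕ) [Fact p.Prime] (F : Type*) [Field F] (n j : ℕ) :
    (s p F n).coeff (-1 / (p : ℚ) ^ (j + 1)) = (j.choose n : F) :=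
  HahnSeries.embDomain_coeff (f := expo p)

theorem s_coeff_of_ne (p : ℕ) [Fact p.Prime] (F : Type*) [Field F] (n : ℕ) (q : ℚ)
    (hq : ∀ j : ℕ, q ≠ -1 / (p : ℚ) ^ (j + 1)) : (s p F n).coeff q = 0 :=
  HahnSeries.embDomain_of_notMem_range (f := expo p) (by rintro ⟨j, rfl⟩; exact hq j rfl)

/-- The indeterminate `t`. -/
def t (F : Type*) [Field F] : Hahn F := HahnSeries.single 1 1

/-- The truncation `s_{n,n} = ∑_{m = 0}^{n - 1} t ^ m s_m`. -/
def sDiag (p : ℕ) [Fact p.Prime] (F : Type*) [Field F] (n : ℕ) : Hahn F :=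
  ∑ m ∈ Finset.range n, t F ^ m * s p F m

end HahnTower

end

/-! Write `℘ x = x ^ p - x`. Pascal's rule gives `℘ s_{m+1} = s_m`, and `℘ s_0 = t⁻¹`, so the `s_m`
form an Artin-Schreier tower over `K`.

The degree of `s_m` is exactly `p ^ (m + 1)` (`natDegree_minpoly_s`). The extension `K(s_m)/K` is
Galois, and its automorphisms translate `s_m` by constants, which form an `F_p`-subspace of `F`. If
this subspace had dimension at most `m`, an `F`-linear relation among the iterates of `℘` on it
would produce a Galois-invariant combination of `s_0, …, s_m`. That is impossible, since these are
`F`-independent modulo `K`.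

Any `u` in the ball generates a field containing `s_0, …, s_{n-1}` (`s_mem_adjoin_of_mem_ball`).
Once the earlier terms are removed, `u` yields an approximation of `s_i` with error of valuation at
least `0`, and Hensel's lemma for `℘` (`mem_of_pow_sub_mem`) makes it exact. Hence `deg u ≥ deg
s_{n-1} = p ^ n`. The centre attains this bound because it lies in `K(s_{n-1})`. -/

noncomputable section

namespace HahnTower

/-! ### Elementary properties of the valuation. -/

section Valuation

variable {F : Type*} [Field F]

theorem le_v_iff {x : Hahn F} {q : ℚ} :
    (q : WithTop ℚ) ≤ v x ↔ ∀ r < q, x.coeff r = 0 := by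
  unfold v
  rw [HahnSeries.le_orderTop_iff_forall]
  exact ⟨fun h r hr => h r (by exact_mod_cast hr), fun h r hr => h r (by exact_mod_cast hr)⟩

theorem le_v_add {x y : Hahn F} {q : WithTop ℚ} (hx : q ≤ v x) (hy : q ≤ v y) :
    q ≤ v (x + y) :=
  (le_min hx hy).trans HahnSeries.min_orderTop_le_orderTop_add

theorem v_neg (x : Hahn F) : v (-x) = v x := HahnSeries.orderTop_neg

theorem le_v_sub {x y : Hahn F} {q : WithTop ℚ} (hx : q ≤ v x) (hy : q ≤ v y) :
    q ≤ v (x - y) := by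
  rw [sub_eq_add_neg]
  exact le_v_add hx (by rwa [v_neg])

theorem v_zero : v (0 : Hahn F) = ⊤ := HahnSeries.orderTop_zero

theorem v_mul (x y : Hahn F) : v (x * y) = v x + v y := HahnSeries.orderTop_mul x y

theorem le_v_mul {x y : Hahn F} {q r : ℚ} (hx : (q : WithTop ℚ) ≤ v x)
    (hy : (r : WithTop ℚ) ≤ v y) : ((q + r : ℚ) : WithTop ℚ) ≤ v (x * y) := by
  rw [v_mul, WithTop.coe_add]
  exact add_le_add hx hy

theorem exists_v_eq {x : Hahn F} (hx : x ≠ 0) : ∃ q : ℚ, v x = q :=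
  ⟨_, (WithTop.coe_untop (v x) (HahnSeries.orderTop_ne_top.2 hx)).symm⟩

theorem le_v_pow {x : Hahn F} {q : ℚ} (hx : (q : WithTop ℚ) ≤ v x) (k : ℕ) :
    ((k * q : ℚ) : WithTop ℚ) ≤ v (x ^ k) := by
  induction k with
  | zero =>
    rw [pow_zero]
    exact le_of_eq (by simp [v])
  | succ k ih =>
    rw [pow_succ]
    convert le_v_mul ih hx using 2
    push_cast
    ring

theorem le_v_sum {ι : Type*} {I : Finset ι} {f : ι → Hahn F} {q : WithTop ℚ}
    (h : ∀ i ∈ I, q ≤ v (f i)) : q ≤ v (∑ i ∈ I, f i) := by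
  classical
  induction I using Finset.induction_on with
  | empty => simp [v_zero]
  | insert i I hi ih =>
    rw [Finset.sum_insert hi]
    exact le_v_add (h i (by simp)) (ih fun j hj => h j (by simp [hj]))

theorem eq_zero_of_forall_le_v {x : Hahn F} (h : ∀ q : ℚ, (q : WithTop ℚ) ≤ v x) : x = 0 := by
  ext r
  exact le_v_iff.1 (h (r + 1)) r (by linarith)

end Valuation

/-! ### Completeness of `F((t^{1/N}))` and closedness of its finite-dimensional spans. -/

section Complete

variable {F : Type*} [Field F]

/-- The field `F((t^{1/N}))` is complete for the valuation `v`. -/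
theorem exists_limit_mem_laurentRoot {N : ℕ+} (a : ℕ → Hahn F) (ha : ∀ i, a i ∈ laurentRoot F N)
    (hc : ∀ i j : ℕ, i ≤ j → ((i : ℚ) : WithTop ℚ) ≤ v (a i - a j)) :
    ∃ b ∈ laurentRoot F N, ∀ i : ℕ, ((i : ℚ) : WithTop ℚ) ≤ v (b - a i) := by
  have hco : ∀ i j : ℕ, ∀ r : ℚ, r < i → r < j → (a i).coeff r = (a j).coeff r := by
    have key : ∀ i j : ℕ, i ≤ j → ∀ r : ℚ, r < i → (a i).coeff r = (a j).coeff r := by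
      intro i j hij r hr
      have := le_v_iff.1 (hc i j hij) r hr
      rwa [HahnSeries.coeff_sub, sub_eq_zero] at this
    intro i j r hi hj
    rcases le_total i j with h | h
    · exact key i j h r hi
    · exact (key j i h r hj).symm
  -- The coefficient of the limit at `r` is read off `a (m r)`: it is stable from there on, since `r
  -- < m r`.
  let m : ℚ → ℕ := fun r => ⌊r⌋₊ + 1
  have hm : ∀ r : ℚ, r < m r := fun r => by
    simpa [m] using Nat.lt_floor_add_one r
  have hN : (0 : ℚ) < ((N : ℕ) : ℚ) := by exact_mod_cast N.pos
  -- Below `0` the support is that of `a 0`; from `0` on it lies in `ℕ / N`, which is well ordered.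
  have hpwo : (Function.support fun r : ℚ => (a (m r)).coeff r).IsPWO := by
    have h2 : (Set.range fun k : ℕ => (k : ℚ) / ((N : ℕ) : ℚ)).IsPWO := by
      rw [← Set.image_univ]
      refine (Set.IsWF.isPWO (Set.IsWF.of_wellFoundedLT _)).image_of_monotone ?_
      intro x y hxy
      have : (x : ℚ) ≤ y := by exact_mod_cast hxy
      exact (div_le_div_iff_of_pos_right hN).2 this
    refine ((a 0).isPWO_support.union h2).mono ?_
    intro r hr
    rcases lt_or_ge r 0 with h | h
    · left
      have := hco (m r) 0 r (hm r) (by simpa using h)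
      simpa [HahnSeries.mem_support, ← this] using hr
    · right
      obtain ⟨k, hk⟩ := mem_laurentRoot.1 (ha (m r)) r hr
      have hk0 : 0 ≤ k := by
        have h1 : 0 ≤ (k : ℚ) := by
          rw [hk] at h
          by_contra hlt
          push Not at hlt
          exact absurd (div_neg_of_neg_of_pos hlt hN) (not_lt.2 h)
        exact_mod_cast h1
      refine ⟨k.toNat, ?_⟩
      have : ((k.toNat : ℕ) : ℚ) = (k : ℚ) := by exact_mod_cast Int.toNat_of_nonneg hk0
      simp only [this, hk]
  refine ⟨⟨fun r => (a (m r)).coeff r, hpwo⟩, ?_, ?_⟩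
  · rw [mem_laurentRoot]
    intro q hq
    exact mem_laurentRoot.1 (ha (m q)) q hq
  · intro i
    rw [le_v_iff]
    intro r hr
    rw [HahnSeries.coeff_sub, sub_eq_zero]
    exact hco (m r) i r (hm r) hr

/-- A set is closed for the valuation topology of `H`. -/
def VClosed (W : Set (Hahn F)) : Prop :=
  ∀ x : Hahn F, (∀ q : ℚ, ∃ y ∈ W, (q : WithTop ℚ) ≤ v (x - y)) → x ∈ W

/-- Finite-dimensional subspaces over `F((t^{1/N}))` are closed. -/
theorem vClosed_span {N : ℕ+} (I : Finset (Hahn F)) :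
    VClosed (Submodule.span (laurentRoot F N) (I : Set (Hahn F)) : Set (Hahn F)) := by
  classical
  induction I using Finset.induction_on with
  | empty =>
    intro x hx
    have : x = 0 := eq_zero_of_forall_le_v fun q => by
      obtain ⟨y, hy, h⟩ := hx q
      have : y = 0 := by simpa using hy
      simpa [this] using h
    simp [this]
  | insert e I he ih =>
    set W := Submodule.span (laurentRoot F N) (I : Set (Hahn F)) with hW
    rw [Finset.coe_insert]
    by_cases heW : e ∈ W
    · rwa [Submodule.span_insert_eq_span heW]
    -- Since `W` is closed and misses `e`, the distance from `e` to `W` is bounded below.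
    have hC : ∃ C : ℚ, ∀ w ∈ W, ¬ ((C : WithTop ℚ) ≤ v (e - w)) := by
      by_contra! hcon
      exact heW (ih e hcon)
    obtain ⟨C, hC⟩ := hC
    have he0 : e ≠ 0 := fun h => heW (h ▸ W.zero_mem)
    obtain ⟨E, hE⟩ := exists_v_eq he0
    intro x hx
    have hdec : ∀ q : ℚ, ∃ a : laurentRoot F N, ∃ w ∈ W,
        (q : WithTop ℚ) ≤ v (x - ((a : Hahn F) * e + w)) := by
      intro q
      obtain ⟨y, hy, h⟩ := hx q
      obtain ⟨a, w, hw, rfl⟩ := Submodule.mem_span_insert.1 hy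
      exact ⟨a, w, hw, h⟩
    choose a w hw hq using hdec
    -- Dividing by `a q - a q'` turns closeness of two approximations into closeness of `e` to `W`,
    -- which `hC` limits. So the coefficients of `e` are Cauchy, with a loss of `C`.
    have hcauchy : ∀ q q' : ℚ, q ≤ q' →
        ((q - C : ℚ) : WithTop ℚ) ≤ v ((a q : Hahn F) - (a q' : Hahn F)) := by
      intro q q' hqq
      by_cases h0 : a q = a q'
      · simp [h0, v_zero]
      have hd : (a q : Hahn F) - (a q' : Hahn F) ≠ 0 := fun h => h0 (Subtype.ext (sub_eq_zero.1 h))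
      obtain ⟨D, hD⟩ := exists_v_eq hd
      have h1 : (q : WithTop ℚ) ≤ v (((a q : Hahn F) - (a q' : Hahn F)) * e + (w q - w q')) := by
        have h2 : (q : WithTop ℚ) ≤ v (x - ((a q' : Hahn F) * e + w q')) :=
          le_trans (by exact_mod_cast hqq) (hq q')
        convert le_v_sub h2 (hq q) using 2
        ring
      have hmem : (a q - a q')⁻¹ • (w q' - w q) ∈ W :=
        W.smul_mem _ (W.sub_mem (hw _) (hw _))
      have h3 := hC _ hmem
      have h4 : ((a q : Hahn F) - (a q' : Hahn F)) * e + (w q - w q') =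
          ((a q : Hahn F) - (a q' : Hahn F)) * (e - (a q - a q')⁻¹ • (w q' - w q)) := by
        have : ((a q - a q')⁻¹ • (w q' - w q) : Hahn F) =
            ((a q : Hahn F) - (a q' : Hahn F))⁻¹ * (w q' - w q) := rfl
        rw [this, mul_sub, mul_inv_cancel_left₀ hd]
        ring
      rw [h4, v_mul, hD] at h1
      rw [hD]
      by_contra hcon
      apply h3
      have hcon' : D < q - C := by exact_mod_cast not_le.1 hcon
      by_cases hz : e - (a q - a q')⁻¹ • (w q' - w q) = 0
      · rw [hz, v_zero]
        exact le_top
      · obtain ⟨G, hG⟩ := exists_v_eq hz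
        rw [hG] at h1 ⊢
        have : q ≤ D + G := by exact_mod_cast h1
        have : C ≤ G := by linarith
        exact_mod_cast this
    obtain ⟨b, hb, hlim⟩ := exists_limit_mem_laurentRoot (fun i : ℕ => (a (i + C) : Hahn F))
      (fun i => (a _).2) (fun i j hij => by
        have := hcauchy (i + C) (j + C) (by have : (i : ℚ) ≤ j := by exact_mod_cast hij
                                            linarith)
        simpa using this)
    have hxb : x - b * e ∈ W := by
      apply ih
      intro q
      obtain ⟨i, hi⟩ := exists_nat_ge (max (q - C) (q - E))
      refine ⟨w (i + C), hw _, ?_⟩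
      have h1 : (q : WithTop ℚ) ≤ v (x - ((a (i + C) : Hahn F) * e + w (i + C))) := by
        refine le_trans ?_ (hq (i + C))
        have := (le_max_left _ _).trans hi
        have : q ≤ i + C := by linarith
        exact_mod_cast this
      have h2 : (q : WithTop ℚ) ≤ v ((b - (a (i + C) : Hahn F)) * e) := by
        refine le_trans ?_ (le_v_mul (hlim i) hE.ge)
        have := (le_max_right _ _).trans hi
        have : q ≤ i + E := by linarith
        exact_mod_cast this
      convert le_v_sub h1 h2 using 2
      ring
    have : x = (⟨b, hb⟩ : laurentRoot F N) • e + (x - b * e) := by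
      change x = b * e + _
      ring
    exact Submodule.mem_span_insert.2 ⟨_, _, hxb, this⟩

end Complete

/-! ### Hensel's lemma for `w ^ p - w` over algebraic extensions of `K`. -/

section Hensel

variable {F : Type*} [Field F]

theorem laurentRoot_le_of_dvd {N M : ℕ+} (h : N ∣ M) : laurentRoot F N ≤ laurentRoot F M := by
  obtain ⟨k, rfl⟩ := h
  exact laurentRoot_le_mul N k

theorem exists_laurentRoot_of_finset {ι : Type*} (I : Finset ι) (f : ι → Puiseux F) :
    ∃ N, ∀ i ∈ I, (f i : Hahn F) ∈ laurentRoot F N := by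
  choose N hN using fun i => (f i).2
  exact ⟨∏ i ∈ I, N i, fun i hi => laurentRoot_le_of_dvd (Finset.dvd_prod_of_mem N hi) (hN i)⟩

theorem laurentRoot_le_Puiseux (N : ℕ+) : laurentRoot F N ≤ Puiseux F := fun _ hx => ⟨N, hx⟩

/-- The powers of an element algebraic over `K` span a finite-dimensional space over some
`F((t^{1/N}))`. -/
theorem exists_span_pow {z : Hahn F} (hz : IsIntegral (Puiseux F) z) :
    ∃ N : ℕ+, ∃ I : Finset (Hahn F), (∀ y ∈ I, ∃ k : ℕ, y = z ^ k) ∧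
      ∀ k : ℕ, z ^ k ∈ Submodule.span (laurentRoot F N) (I : Set (Hahn F)) := by
  classical
  set f := minpoly (Puiseux F) z with hf
  set d := f.natDegree with hd
  obtain ⟨N, hN⟩ := exists_laurentRoot_of_finset (Finset.range d) fun i => f.coeff i
  refine ⟨N, (Finset.range d).image (z ^ ·), ?_, ?_⟩
  · intro y hy
    obtain ⟨k, -, rfl⟩ := Finset.mem_image.1 hy
    exact ⟨k, rfl⟩
  set W := Submodule.span (laurentRoot F N) (((Finset.range d).image (z ^ ·) : Finset (Hahn F)) :
    Set (Hahn F)) with hW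
  have hzd : z ^ d = - ∑ i ∈ Finset.range d, (f.coeff i : Hahn F) * z ^ i := by
    have h1 : Polynomial.aeval z f = 0 := minpoly.aeval _ _
    rw [Polynomial.aeval_eq_sum_range, Finset.sum_range_succ, ← hd] at h1
    have h2 : f.coeff d = 1 := minpoly.monic hz
    rw [h2, one_smul] at h1
    exact eq_neg_of_add_eq_zero_right h1
  intro k
  induction k using Nat.strong_induction_on with
  | _ k ih =>
    rcases lt_or_ge k d with h | h
    · exact Submodule.subset_span (by
        simpa using ⟨k, h, rfl⟩)
    · obtain ⟨j, rfl⟩ := Nat.exists_eq_add_of_le h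
      rw [pow_add, hzd, neg_mul, Finset.sum_mul]
      refine W.neg_mem (W.sum_mem fun i hi => ?_)
      have h3 := ih (i + j) (by have := Finset.mem_range.1 hi; omega)
      have h4 := W.smul_mem (⟨_, hN i hi⟩ : laurentRoot F N) h3
      have h5 : (f.coeff i : Hahn F) * z ^ i * z ^ j =
          (⟨_, hN i hi⟩ : laurentRoot F N) • z ^ (i + j) := by
        change _ = (f.coeff i : Hahn F) * z ^ (i + j)
        ring
      rwa [h5]

/-- Hensel's lemma for the Artin-Schreier polynomial over an algebraic extension of `K`. -/
theorem mem_of_pow_sub_mem {p : ℕ} [hp : Fact p.Prime] [CharP (Hahn F) p]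
    (E : IntermediateField (Puiseux F) (Hahn F)) {w : Hahn F} (hw : 0 < v w)
    (hE : w ^ p - w ∈ E) (hint : IsIntegral (Puiseux F) (w ^ p - w)) : w ∈ E := by
  set z := w ^ p - w with hz
  obtain ⟨N, I, hI, hpow⟩ := exists_span_pow hint
  have hle : ∀ y ∈ Submodule.span (laurentRoot F N) (I : Set (Hahn F)), y ∈ E := by
    intro y hy
    induction hy using Submodule.span_induction with
    | mem y hy =>
      obtain ⟨k, rfl⟩ := hI y hy
      exact pow_mem hE k
    | zero => exact zero_mem E
    | add x y _ _ hx hy => exact add_mem hx hy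
    | smul a x _ hx =>
      exact E.smul_mem (x := (⟨a, laurentRoot_le_Puiseux N a.2⟩ : Puiseux F)) hx
  apply hle
  apply vClosed_span I
  intro q
  by_cases hw0 : w = 0
  · refine ⟨0, Submodule.zero_mem _, ?_⟩
    simp [hw0, v_zero]
  obtain ⟨r, hr⟩ := exists_v_eq hw0
  have hr0 : 0 < r := by
    rw [hr] at hw
    exact_mod_cast hw
  -- By Frobenius the sum telescopes, so `-∑ z ^ p ^ i` approximates `w` with error `w ^ p ^ k`,
  -- which tends to `0` because `v w > 0`.
  have htel : ∀ k : ℕ, ∑ i ∈ Finset.range k, z ^ p ^ i = w ^ p ^ k - w := by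
    intro k
    induction k with
    | zero => simp
    | succ k ih =>
      rw [Finset.sum_range_succ, ih, hz, sub_pow_char_pow, ← pow_mul, ← pow_succ']
      ring
  obtain ⟨k, hk⟩ := exists_nat_ge (q / r)
  refine ⟨-∑ i ∈ Finset.range k, z ^ p ^ i,
    Submodule.neg_mem _ (Submodule.sum_mem _ fun i _ => hpow _), ?_⟩
  rw [htel, sub_neg_eq_add, add_sub_cancel]
  refine le_trans ?_ (le_v_pow hr.ge (p ^ k))
  have h1 : q ≤ k * r := (div_le_iff₀ hr0).1 hk
  have h2 : (k : ℚ) ≤ ((p ^ k : ℕ) : ℚ) := by exact_mod_cast (Nat.lt_pow_self hp.out.one_lt).le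
  have : q ≤ ((p ^ k : ℕ) : ℚ) * r := h1.trans (by gcongr)
  exact_mod_cast this

end Hensel

/-! ### Artin-Schreier equations of the series `s_m`. -/

section Series

variable (p : ℕ) [hp : Fact p.Prime] {F : Type*} [Field F]

/-- The series `∑_j b_j t ^ (-1 / p ^ (j + 1))`. -/
def expoSeries (b : ℕ → F) : Hahn F :=
  HahnSeries.embDomain (expo p) ⟨b, Set.IsWF.isPWO (Set.IsWF.of_wellFoundedLT _)⟩

theorem expoSeries_coeff (b : ℕ → F) (j : ℕ) : (expoSeries p b).coeff (expo p j) = b j :=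
  HahnSeries.embDomain_coeff (f := expo p)

theorem expoSeries_coeff_of_ne (b : ℕ → F) {q : ℚ} (hq : ∀ j, q ≠ expo p j) :
    (expoSeries p b).coeff q = 0 :=
  HahnSeries.embDomain_of_notMem_range (f := expo p) (by rintro ⟨j, rfl⟩; exact hq j rfl)

theorem expo_apply (j : ℕ) : expo p j = -1 / (p : ℚ) ^ (j + 1) := rfl

theorem expo_neg (j : ℕ) : expo p j < 0 := by
  have : (0 : ℚ) < p := by exact_mod_cast hp.out.pos
  rw [expo_apply]
  exact div_neg_of_neg_of_pos (by norm_num) (by positivity)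

theorem natCast_mul_expo_succ (j : ℕ) : (p : ℚ) * expo p (j + 1) = expo p j := by
  have : (p : ℚ) ≠ 0 := by exact_mod_cast hp.out.ne_zero
  rw [expo_apply, expo_apply, pow_succ' _ (j + 1)]
  field_simp

theorem natCast_mul_expo_zero : (p : ℚ) * expo p 0 = -1 := by
  have : (p : ℚ) ≠ 0 := by exact_mod_cast hp.out.ne_zero
  rw [expo_apply, zero_add, pow_one]
  field_simp

theorem exists_lt_expo {r : ℚ} (hr : r < 0) : ∃ j, r < expo p j := by
  have h1 : (1 : ℚ) < p := by exact_mod_cast hp.out.one_lt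
  obtain ⟨j, hj⟩ := pow_unbounded_of_one_lt (-r)⁻¹ h1
  refine ⟨j, ?_⟩
  have h0 : (0 : ℚ) < (p : ℚ) ^ j := by positivity
  have h2 : (p : ℚ) ^ j < (p : ℚ) ^ (j + 1) := pow_lt_pow_right₀ h1 (by omega)
  have h3 : (-r)⁻¹ < (p : ℚ) ^ (j + 1) := hj.trans h2
  rw [expo_apply, lt_div_iff₀ (h0.trans h2)]
  have h4 := (inv_lt_iff_one_lt_mul₀' (by linarith : 0 < -r)).1 h3
  nlinarith

theorem expoSeries_sub_sum_coeff (b : ℕ → F) (J : ℕ) {r : ℚ} (hr : r < expo p J ∨ 0 ≤ r) :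
    (expoSeries p b - ∑ j ∈ Finset.range J, HahnSeries.single (expo p j) (b j)).coeff r = 0 := by
  rw [HahnSeries.coeff_sub, HahnSeries.coeff_sum]
  by_cases h : ∃ k, r = expo p k
  · obtain ⟨k, rfl⟩ := h
    have hk : k < J := by
      rcases hr with h | h
      · exact (expo p).lt_iff_lt.1 h
      · exact absurd (expo_neg p k) (not_lt.2 h)
    rw [expoSeries_coeff, Finset.sum_eq_single k]
    · simp
    · intro j _ hj
      exact HahnSeries.coeff_single_of_ne fun h => hj ((expo p).injective h).symm
    · intro h
      exact absurd (Finset.mem_range.2 hk) h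
  · push Not at h
    rw [expoSeries_coeff_of_ne p b h, Finset.sum_eq_zero, sub_zero]
    intro j _
    exact HahnSeries.coeff_single_of_ne (h j)

theorem pow_coeff_of_nonneg {x : Hahn F} (hx : ∀ r, 0 ≤ r → x.coeff r = 0) {k : ℕ} (hk : k ≠ 0) :
    ∀ r, 0 ≤ r → (x ^ k).coeff r = 0 := by
  induction k with
  | zero => exact absurd rfl hk
  | succ k ih =>
    rcases eq_or_ne k 0 with rfl | hk0
    · simpa using hx
    intro r hr
    by_contra hne
    rw [pow_succ] at hne
    obtain ⟨a, ha, c, hc, rfl⟩ := HahnSeries.support_mul_subset hne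
    have h1 : a < 0 := by
      by_contra h
      exact ha (ih hk0 a (not_lt.1 h))
    have h2 : c < 0 := by
      by_contra h
      exact hc (hx c (not_lt.1 h))
    change 0 ≤ a + c at hr
    linarith

/-- Frobenius multiplies exponents by `p`, which shifts `-1 / p ^ (j + 2)` to `-1 / p ^ (j + 1)` and
sends the first exponent to `-1`. The identity is exact on truncations; the tails are controlled by
the valuation at negative exponents and vanish at nonnegative ones. -/
theorem expoSeries_pow [CharP (Hahn F) p] (b : ℕ → F) :
    expoSeries p b ^ p =
      HahnSeries.single (-1) (b 0 ^ p) + expoSeries p fun j => b (j + 1) ^ p := by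
  rw [← sub_eq_zero]
  have key : ∀ J : ℕ, expoSeries p b ^ p -
      (HahnSeries.single (-1) (b 0 ^ p) + expoSeries p fun j => b (j + 1) ^ p) =
      (expoSeries p b -
        ∑ j ∈ Finset.range (J + 1), HahnSeries.single (expo p j) (b j)) ^ p -
      ((expoSeries p fun j => b (j + 1) ^ p) -
        ∑ j ∈ Finset.range J, HahnSeries.single (expo p j) (b (j + 1) ^ p)) := by
    intro J
    rw [sub_pow_char, sum_pow_char, Finset.sum_range_succ']
    simp only [HahnSeries.single_pow, nsmul_eq_mul, natCast_mul_expo_zero, natCast_mul_expo_succ]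
    ring
  have htail : ∀ (J : ℕ) (c : ℕ → F), ((expo p J : ℚ) : WithTop ℚ) ≤
      v (expoSeries p c - ∑ j ∈ Finset.range J, HahnSeries.single (expo p j) (c j)) :=
    fun J c => le_v_iff.2 fun r hr => expoSeries_sub_sum_coeff p c J (Or.inl hr)
  ext r
  rcases lt_or_ge r 0 with hr | hr
  · obtain ⟨J, hJ⟩ := exists_lt_expo p hr
    have h1 := le_v_pow (htail (J + 1) b) p
    rw [natCast_mul_expo_succ] at h1
    have h2 := le_v_sub h1 (htail J fun j => b (j + 1) ^ p)
    rw [← key] at h2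
    exact le_v_iff.1 h2 r hJ
  · rw [key 0, HahnSeries.coeff_sub,
      pow_coeff_of_nonneg (fun r hr => expoSeries_sub_sum_coeff p b _ (Or.inr hr))
        hp.out.ne_zero r hr,
      expoSeries_sub_sum_coeff p _ 0 (Or.inr hr)]
    simp

theorem expoSeries_add (b c : ℕ → F) :
    expoSeries p (b + c) = expoSeries p b + expoSeries p c := by
  ext r
  rw [HahnSeries.coeff_add]
  by_cases h : ∃ k, r = expo p k
  · obtain ⟨k, rfl⟩ := h
    simp only [expoSeries_coeff, Pi.add_apply]
  · push Not at h
    simp only [expoSeries_coeff_of_ne p _ h, add_zero]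

variable (F) in
theorem s_eq_expoSeries (m : ℕ) : s p F m = expoSeries p fun j => (j.choose m : F) := rfl

theorem natCast_pow_char {R : Type*} [CommRing R] [CharP R p] (k : ℕ) : (k : R) ^ p = k := by
  have := map_natCast (frobenius R p) k
  rwa [frobenius_def] at this

variable (F) in
theorem t_inv_eq : (t F)⁻¹ = HahnSeries.single (-1) 1 := by
  refine (eq_inv_of_mul_eq_one_left ?_).symm
  rw [t, HahnSeries.single_mul_single]
  simp

variable (F) in
theorem s_zero_pow [CharP F p] [CharP (Hahn F) p] : s p F 0 ^ p - s p F 0 = (t F)⁻¹ := by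
  rw [s_eq_expoSeries, expoSeries_pow, t_inv_eq]
  simp

variable (F) in
theorem s_succ_pow [CharP F p] [CharP (Hahn F) p] (m : ℕ) :
    s p F (m + 1) ^ p - s p F (m + 1) = s p F m := by
  simp only [s_eq_expoSeries]
  rw [expoSeries_pow, sub_eq_iff_eq_add, ← expoSeries_add]
  simp only [natCast_pow_char]
  rw [Nat.choose_zero_succ, Nat.cast_zero, map_zero, zero_add]
  congr 1
  funext j
  -- Frobenius fixes the binomial coefficients, so the equation is Pascal's rule.
  rw [Nat.choose_succ_succ, Nat.cast_add, Pi.add_apply]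

variable (F) in
theorem le_v_s (m : ℕ) : ((-1 / p : ℚ) : WithTop ℚ) ≤ v (s p F m) := by
  have := le_v_iff.2 fun r hr => expoSeries_sub_sum_coeff p (fun j => (j.choose m : F)) 0
    (r := r) (Or.inl hr)
  rw [Finset.range_zero, Finset.sum_empty, sub_zero, expo_apply, zero_add, pow_one] at this
  exact this

end Series

/-! ### Linear independence of the `s_m` over `F` modulo `K`. -/

section Independence

variable (p : ℕ) [hp : Fact p.Prime] {F : Type*} [Field F]

/-- Differencing in `j` lowers each binomial by Pascal's rule and eliminates `b 0`, so induction on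
`n` applies even though the relation is known only for large `j`. -/
theorem eq_zero_of_sum_choose_eq_zero (n : ℕ) (b : ℕ → F) (J : ℕ)
    (h : ∀ j ≥ J, ∑ m ∈ Finset.range n, b m * (j.choose m : F) = 0) : ∀ m < n, b m = 0 := by
  induction n generalizing b with
  | zero => intro m hm; omega
  | succ n ih =>
    have hsucc : ∀ m < n, b (m + 1) = 0 := by
      refine ih (fun m => b (m + 1)) fun j hj => ?_
      have h1 := h j hj
      have h2 := h (j + 1) (by omega)
      rw [Finset.sum_range_succ'] at h1 h2
      simp only [Nat.choose_succ_succ, Nat.cast_add, mul_add, Finset.sum_add_distrib] at h2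
      simp only [Nat.choose_zero_right] at h1 h2
      linear_combination h2 - h1
    intro m hm
    rcases m with _ | m
    · have h1 := h J le_rfl
      rw [Finset.sum_range_succ', Finset.sum_eq_zero fun m hm => by
        rw [hsucc m (Finset.mem_range.1 hm), zero_mul]] at h1
      simpa using h1
    · exact hsucc m (by omega)

/-- The series `s_0, …, s_{n-1}` are linearly independent over `F` modulo `K`. -/
theorem eq_zero_of_sum_s_mem_Puiseux (n : ℕ) (b : ℕ → F)
    (h : ∑ m ∈ Finset.range n, HahnSeries.C (b m) * s p F m ∈ Puiseux F) :
    ∀ m < n, b m = 0 := by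
  obtain ⟨N, hN⟩ := h
  refine eq_zero_of_sum_choose_eq_zero n b N fun j hj => ?_
  by_contra hne
  have hp0 : (p : ℚ) ≠ 0 := by exact_mod_cast hp.out.ne_zero
  have hN0 : ((N : ℕ) : ℚ) ≠ 0 := by exact_mod_cast N.ne_zero
  -- A nonzero coefficient here would force `p ^ (j + 1) ∣ N`, contradicting `N ≤ j`.
  obtain ⟨k, hk⟩ := mem_laurentRoot.1 hN (-1 / (p : ℚ) ^ (j + 1)) (by
    rw [HahnSeries.mem_support, HahnSeries.coeff_sum]
    simpa only [HahnSeries.C_mul_eq_smul, HahnSeries.coeff_smul, s_coeff, smul_eq_mul] using hne)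
  have h1 : ((N : ℕ) : ℤ) = (p : ℤ) ^ (j + 1) * (-k) := by
    have : ((N : ℕ) : ℚ) = (p : ℚ) ^ (j + 1) * (-k) := by
      field_simp at hk
      linarith
    exact_mod_cast this
  have h2 : p ^ (j + 1) ∣ (N : ℕ) := by
    have : ((p ^ (j + 1) : ℕ) : ℤ) ∣ ((N : ℕ) : ℤ) := ⟨-k, by rw [h1]; push_cast; ring⟩
    exact_mod_cast this
  have h3 := Nat.le_of_dvd N.pos h2
  have h4 : j + 1 < p ^ (j + 1) := Nat.lt_pow_self hp.out.one_lt
  omega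

end Independence

/-! ### Galois theory of iterated Artin-Schreier equations. -/

section ArtinSchreier

/-- The Artin-Schreier operator `x ↦ x ^ p - x`. -/
def artinSchreier (p : ℕ) {R : Type*} [CommRing R] (x : R) : R := x ^ p - x

/-- The polynomial inducing the `k`-th iterate of the Artin-Schreier operator. -/
def artinSchreierPoly (p : ℕ) (R : Type*) [CommRing R] (k : ℕ) : Polynomial R :=
  (artinSchreier p)^[k] Polynomial.X

theorem artinSchreierPoly_succ (p : ℕ) (R : Type*) [CommRing R] (k : ℕ) :
    artinSchreierPoly p R (k + 1) = artinSchreierPoly p R k ^ p - artinSchreierPoly p R k :=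
  Function.iterate_succ_apply' _ _ _

theorem map_artinSchreier_iterate (p : ℕ) {R S : Type*} [CommRing R] [CommRing S] (f : R →+* S)
    (k : ℕ) (x : R) : f ((artinSchreier p)^[k] x) = (artinSchreier p)^[k] (f x) := by
  refine Function.Semiconj.iterate_right (f := f) (fun x => ?_) k x
  simp [artinSchreier]

theorem aeval_artinSchreierPoly (p : ℕ) {R A : Type*} [CommRing R] [CommRing A] [Algebra R A] (k : ℕ)
    (y : A) : Polynomial.aeval y (artinSchreierPoly p R k) = (artinSchreier p)^[k] y := by
  have := map_artinSchreier_iterate p (Polynomial.aeval (R := R) y).toRingHom k Polynomial.X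
  simpa [artinSchreierPoly] using this

theorem map_artinSchreierPoly (p : ℕ) {R S : Type*} [CommRing R] [CommRing S] (f : R →+* S) (k : ℕ) :
    (artinSchreierPoly p R k).map f = artinSchreierPoly p S k := by
  have := map_artinSchreier_iterate p (Polynomial.mapRingHom f) k Polynomial.X
  simpa [artinSchreierPoly] using this

theorem derivative_artinSchreierPoly (p : ℕ) (R : Type*) [CommRing R] [CharP R p] (k : ℕ) :
    Polynomial.derivative (artinSchreierPoly p R k) = (-1) ^ k := by
  induction k with
  | zero => simp [artinSchreierPoly]
  | succ k ih =>
    rw [artinSchreierPoly_succ, Polynomial.derivative_sub, Polynomial.derivative_pow, ih,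
      CharP.cast_eq_zero, Polynomial.C_0]
    ring

variable (p : ℕ) [hp : Fact p.Prime]

theorem artinSchreier_iterate_add {R : Type*} [CommRing R] [CharP R p] (k : ℕ) (x y : R) :
    (artinSchreier p)^[k] (x + y) = (artinSchreier p)^[k] x + (artinSchreier p)^[k] y := by
  induction k with
  | zero => rfl
  | succ k ih =>
    simp only [Function.iterate_succ_apply', ih]
    simp only [artinSchreier, add_pow_char]
    ring

/-- The iterates of the Artin-Schreier operator as additive maps. -/
def artinSchreierHom (R : Type*) [CommRing R] [CharP R p] (k : ℕ) : R →+ R :=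
  AddMonoidHom.mk' (artinSchreier p)^[k] (artinSchreier_iterate_add p k)

theorem artinSchreierHom_apply {R : Type*} [CommRing R] [CharP R p] (k : ℕ) (x : R) :
    artinSchreierHom p R k x = (artinSchreier p)^[k] x := rfl

theorem artinSchreier_iterate_sub {R : Type*} [CommRing R] [CharP R p] (k : ℕ) (x y : R) :
    (artinSchreier p)^[k] (x - y) = (artinSchreier p)^[k] x - (artinSchreier p)^[k] y :=
  map_sub (artinSchreierHom p R k) x y

theorem artinSchreierPoly_comp_X_sub_C {R : Type*} [CommRing R] [CharP R p] (k : ℕ) (x : R) :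
    (artinSchreierPoly p R k).comp (Polynomial.X - Polynomial.C x) =
      artinSchreierPoly p R k - Polynomial.C ((artinSchreier p)^[k] x) := by
  have h1 := map_artinSchreier_iterate p
    (Polynomial.compRingHom (Polynomial.X - Polynomial.C x)) k Polynomial.X
  have h2 := map_artinSchreier_iterate p (Polynomial.C (R := R)) k x
  rw [h2]
  simp only [Polynomial.coe_compRingHom_apply, Polynomial.X_comp, artinSchreier_iterate_sub] at h1
  exact h1

theorem artinSchreierPoly_monic_natDegree (R : Type*) [CommRing R] [Nontrivial R] (k : ℕ) :
    (artinSchreierPoly p R k).Monic ∧ (artinSchreierPoly p R k).natDegree = p ^ k := by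
  induction k with
  | zero => exact ⟨Polynomial.monic_X, by simp [artinSchreierPoly]⟩
  | succ k ih =>
    obtain ⟨hm, hd⟩ := ih
    have h1 : (artinSchreierPoly p R k ^ p).natDegree = p ^ (k + 1) := by
      rw [hm.natDegree_pow, hd, pow_succ']
    have h2 : (artinSchreierPoly p R k).natDegree < (artinSchreierPoly p R k ^ p).natDegree := by
      rw [h1, hd]
      exact Nat.pow_lt_pow_right hp.out.one_lt (Nat.lt_succ_self k)
    rw [artinSchreierPoly_succ]
    refine ⟨(hm.pow p).sub_of_left (Polynomial.degree_lt_degree h2), ?_⟩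
    rw [Polynomial.natDegree_sub_eq_left_of_natDegree_lt h2, h1]

/-- Over an algebraically closed field of characteristic `p`, the kernel of an iterate of the
Artin-Schreier operator does not grow in extensions. -/
theorem exists_of_artinSchreier_iterate_eq_zero {F E : Type*} [Field F] [IsAlgClosed F] [Field E]
    [CharP E p] (j : F →+* E) (k : ℕ) (c : E) (hc : (artinSchreier p)^[k] c = 0) :
    ∃ d, j d = c := by
  induction k generalizing c with
  | zero => exact ⟨0, by simpa using hc.symm⟩
  | succ k ih =>
    rw [Function.iterate_succ_apply] at hc
    obtain ⟨b, hb⟩ := ih _ hc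
    obtain ⟨d, hd⟩ := IsAlgClosed.exists_root (artinSchreierPoly p F 1 - Polynomial.C b) (by
      have h := (artinSchreierPoly_monic_natDegree p F 1).2
      have h1 : (artinSchreierPoly p F 1 - Polynomial.C b).natDegree = p := by
        rw [Polynomial.natDegree_sub_C, h, pow_one]
      intro h0
      have := Polynomial.natDegree_eq_of_degree_eq_some h0
      rw [h1] at this
      exact hp.out.ne_zero this)
    have hd' : d ^ p - d = b := by
      have := aeval_artinSchreierPoly p (R := F) 1 d
      rw [Polynomial.IsRoot, Polynomial.eval_sub, Polynomial.eval_C, sub_eq_zero] at hd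
      rw [Polynomial.coe_aeval_eq_eval, hd] at this
      exact this.symm
    -- Two solutions of `x ^ p - x = b` differ by a Frobenius-fixed element, that is, by one of the
    -- prime field.
    have hy : (c - j d) ^ p = c - j d := by
      rw [sub_pow_char, ← map_pow]
      have h2 : c ^ p - c = j b := hb.symm
      rw [← hd', map_sub] at h2
      linear_combination h2
    have hmem : c - j d ∈ j.fieldRange :=
      (bot_le : (⊥ : Subfield E) ≤ j.fieldRange) ((Subfield.mem_bot_iff_pow_eq_self E p).2 hy)
    obtain ⟨e, he⟩ := hmem
    exact ⟨e + d, by rw [map_add, he, sub_add_cancel]⟩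

variable {p}
variable {K L : Type*} [Field K] [Field L] [Algebra K L]

theorem isIntegral_of_artinSchreier_iterate {x : L} {a : K} {k : ℕ}
    (hx : (artinSchreier p)^[k] x = algebraMap K L a) : IsIntegral K x := by
  have h := artinSchreierPoly_monic_natDegree p K k
  refine ⟨artinSchreierPoly p K k - Polynomial.C a, h.1.sub_of_left ?_, ?_⟩
  · refine Polynomial.degree_lt_degree ?_
    rw [Polynomial.natDegree_C, h.2]
    exact pow_pos hp.out.pos k
  · rw [← Polynomial.aeval_def, map_sub, aeval_artinSchreierPoly, hx, Polynomial.aeval_C, sub_self]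

theorem natDegree_minpoly_le_of_artinSchreier_iterate {x : L} {a : K} {k : ℕ}
    (hx : (artinSchreier p)^[k] x = algebraMap K L a) : (minpoly K x).natDegree ≤ p ^ k := by
  have h := artinSchreierPoly_monic_natDegree p K k
  have hd : (artinSchreierPoly p K k - Polynomial.C a).natDegree = p ^ k := by
    rw [Polynomial.natDegree_sub_C, h.2]
  rw [← hd]
  refine Polynomial.natDegree_le_of_dvd (minpoly.dvd K x ?_) ?_
  · rw [map_sub, aeval_artinSchreierPoly, hx, Polynomial.aeval_C, sub_self]
  · intro h0
    rw [h0, Polynomial.natDegree_zero] at hd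
    exact (pow_pos hp.out.pos k).ne hd

variable {F : Type*} [Field F] [IsAlgClosed F] [CharP K p]

/-- The derivative is `±1`, which gives separability. The conjugates of `x` are its translates by
the kernel of the iterate, and this kernel consists of constants from `F`, so adjoining `x` splits
the polynomial. -/
theorem isGalois_of_artinSchreier_iterate (i : F →+* K) {x : L} {a : K} {k : ℕ}
    (hx : (artinSchreier p)^[k] x = algebraMap K L a) :
    IsGalois K (IntermediateField.adjoin K {x}) := by
  set E := IntermediateField.adjoin K {x}
  have : CharP E p := charP_of_injective_algebraMap (algebraMap K E).injective p
  set y : E := IntermediateField.AdjoinSimple.gen K x with hy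
  have hyx : algebraMap E L y = x := IntermediateField.AdjoinSimple.algebraMap_gen K x
  have hya : (artinSchreier p)^[k] y = algebraMap K E a := by
    apply (algebraMap E L).injective
    rw [map_artinSchreier_iterate, hyx, hx]
    rfl
  set f := artinSchreierPoly p K k - Polynomial.C a with hf
  have hsep : f.Separable := by
    have : Polynomial.derivative f = (-1) ^ k := by
      rw [hf, Polynomial.derivative_sub, derivative_artinSchreierPoly, Polynomial.derivative_C,
        sub_zero]
    rw [Polynomial.Separable, this]
    exact ⟨0, (-1) ^ k, by rw [zero_mul, zero_add, ← mul_pow]; simp⟩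
  have hspl : (f.map (algebraMap K E)).Splits := by
    have h1 : f.map (algebraMap K E) =
        (artinSchreierPoly p E k).comp (Polynomial.X - Polynomial.C y) := by
      rw [artinSchreierPoly_comp_X_sub_C, hya, hf, Polynomial.map_sub, map_artinSchreierPoly,
        Polynomial.map_C]
    rw [h1]
    refine Polynomial.Splits.comp_X_sub_C ?_ y
    rw [← map_artinSchreierPoly p ((algebraMap K E).comp i)]
    exact (IsAlgClosed.splits _).map _
  have hroot : x ∈ f.rootSet L := by
    rw [Polynomial.mem_rootSet_of_ne hsep.ne_zero, hf, map_sub, aeval_artinSchreierPoly, hx,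
      Polynomial.aeval_C, sub_self]
  have : f.IsSplittingField K E := by
    refine IntermediateField.isSplittingField_iff.2 ⟨hspl, le_antisymm ?_ ?_⟩
    · exact IntermediateField.adjoin_simple_le_iff.2 (IntermediateField.subset_adjoin K _ hroot)
    · rw [IntermediateField.adjoin_le_iff, ← hspl.image_rootSet E.val]
      rintro _ ⟨z, -, rfl⟩
      exact z.2
  exact IsGalois.of_separable_splitting_field hsep

/-- An element with Artin-Schreier iterates linearly independent over `F` modulo `K`, the
`k`-th one lying in `K`, has degree `p ^ k`. -/
theorem natDegree_minpoly_of_artinSchreier_iterate [Algebra (ZMod p) F] [CharP F p]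
    (i : F →+* K) {x : L} {a : K} {k : ℕ}
    (hx : (artinSchreier p)^[k] x = algebraMap K L a)
    (hind : ∀ g : Fin k → F, ∑ l : Fin k, algebraMap K L (i (g l)) * (artinSchreier p)^[l] x ∈
      (algebraMap K L).range → g = 0) :
    (minpoly K x).natDegree = p ^ k := by
  refine le_antisymm (natDegree_minpoly_le_of_artinSchreier_iterate hx) ?_
  have hxint := isIntegral_of_artinSchreier_iterate hx
  have := isGalois_of_artinSchreier_iterate i hx
  have := IntermediateField.adjoin.finiteDimensional hxint
  rw [← IntermediateField.adjoin.finrank hxint, ← IsGalois.card_aut_eq_finrank]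
  set E := IntermediateField.adjoin K {x}
  have : CharP E p := charP_of_injective_algebraMap (algebraMap K E).injective p
  set y : E := IntermediateField.AdjoinSimple.gen K x with hy
  have hyx : algebraMap E L y = x := IntermediateField.AdjoinSimple.algebraMap_gen K x
  have hya : (artinSchreier p)^[k] y = algebraMap K E a := by
    apply (algebraMap E L).injective
    rw [map_artinSchreier_iterate, hyx, hx]
    rfl
  let j : F →+* E := (algebraMap K E).comp i
  have hj : ∀ (σ : E ≃ₐ[K] E) (c : F), σ (j c) = j c := fun σ c => σ.commutes (i c)
  -- The constants by which automorphisms translate `y`. Each determines its automorphism through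
  -- `τ`, so it suffices to show `p ^ k ≤ |S|`.
  let S : AddSubgroup F :=
    { carrier := {c | ∃ σ : E ≃ₐ[K] E, σ y = y + j c}
      zero_mem' := ⟨1, by simp⟩
      add_mem' := by
        rintro c d ⟨σ, hσ⟩ ⟨τ, hτ⟩
        refine ⟨σ * τ, ?_⟩
        rw [AlgEquiv.mul_apply, hτ, map_add, hσ, hj, map_add, add_assoc]
      neg_mem' := by
        rintro c ⟨σ, hσ⟩
        refine ⟨σ⁻¹, ?_⟩
        apply σ.injective
        rw [← AlgEquiv.mul_apply, mul_inv_cancel, AlgEquiv.one_apply, map_add, hσ, hj, map_neg,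
          add_neg_cancel_right] }
  let V : Submodule (ZMod p) F := AddSubgroup.toZModSubmodule p S
  have hV : ∀ c : V, ∃ σ : E ≃ₐ[K] E, σ y = y + j c := fun c => c.2
  choose τ hτ using hV
  have hτinj : Function.Injective τ := by
    intro c d hcd
    have h := hτ c
    rw [hcd, hτ d, add_right_inj] at h
    exact Subtype.ext (j.injective h.symm)
  have : Finite V := Finite.of_injective τ hτinj
  refine le_trans ?_ (Nat.card_le_card_of_injective τ hτinj)
  rw [Module.natCard_eq_pow_finrank (K := ZMod p), Nat.card_zmod]
  refine Nat.pow_le_pow_right hp.out.pos ?_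
  by_contra hlt
  let ℓ : Fin k → (V →ₗ[ZMod p] F) := fun l =>
    ((artinSchreierHom p F l).toZModLinearMap p).comp V.subtype
  -- The `F`-space of `F_p`-linear maps `V → F` has dimension `dim V < k`, too small for `k`
  -- independent iterates.
  have hdep : ¬ LinearIndependent F ℓ := by
    intro h
    have := h.fintype_card_le_finrank
    rw [Fintype.card_fin, Module.finrank_linearMap_self] at this
    exact hlt this
  obtain ⟨g, hg, l, hl⟩ := Fintype.not_linearIndependent_iff.1 hdep
  refine hl (congrFun (hind g ?_) l)
  -- An automorphism translating `y` by `c ∈ V` changes the sum by `∑ g l * ℘^[l] c`, which is zero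
  -- by the relation `hg`.
  have hfix : ∑ l : Fin k, j (g l) * (artinSchreier p)^[l] y ∈
      (⊥ : IntermediateField K E) := by
    rw [IsGalois.mem_bot_iff_fixed]
    intro σ
    obtain ⟨c, hc⟩ := exists_of_artinSchreier_iterate_eq_zero p j k (σ y - y) (by
      have h := map_artinSchreier_iterate p (σ : E →+* E) k y
      rw [artinSchreier_iterate_sub, hya, sub_eq_zero]
      rw [hya] at h
      exact h.symm.trans (σ.commutes a))
    have hσ : σ y = y + j c := by rw [hc, add_sub_cancel]
    have hz : ∑ l : Fin k, g l * (artinSchreier p)^[l] c = 0 := by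
      have := LinearMap.congr_fun hg ⟨c, σ, hσ⟩
      simpa [ℓ, LinearMap.sum_apply, artinSchreierHom_apply] using this
    have hstep : ∀ l : Fin k, σ (j (g l) * (artinSchreier p)^[l] y) =
        j (g l) * (artinSchreier p)^[l] y + j (g l * (artinSchreier p)^[l] c) := by
      intro l
      have h := map_artinSchreier_iterate p (σ : E →+* E) l y
      have h' : σ ((artinSchreier p)^[l] y) = (artinSchreier p)^[l] (σ y) := h
      rw [map_mul, hj, h', hσ, artinSchreier_iterate_add, ← map_artinSchreier_iterate, map_mul,
        mul_add]
    rw [map_sum, Finset.sum_congr rfl fun l _ => hstep l, Finset.sum_add_distrib, ← map_sum, hz,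
      map_zero, add_zero]
  obtain ⟨b, hb⟩ := IntermediateField.mem_bot.1 hfix
  refine ⟨b, ?_⟩
  have h := congrArg (algebraMap E L) hb
  rw [map_sum] at h
  refine Eq.trans ?_ (h.trans (Finset.sum_congr rfl fun l _ => ?_))
  · rfl
  · rw [map_mul, map_artinSchreier_iterate, hyx]
    rfl

end ArtinSchreier

/-! ### Degrees of `s_m` and of the elements of the ball. -/

section Degree

variable (p : ℕ) [hp : Fact p.Prime] {F : Type*} [Field F]

theorem single_mem_Puiseux (k : ℤ) (c : F) : HahnSeries.single (k : ℚ) c ∈ Puiseux F := by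
  refine ⟨1, mem_laurentRoot.2 fun q hq => ⟨k, ?_⟩⟩
  by_contra hne
  refine hq (HahnSeries.coeff_single_of_ne fun h => hne ?_)
  simpa using h

theorem C_mem_Puiseux (c : F) : HahnSeries.C c ∈ Puiseux F := by
  simpa using single_mem_Puiseux 0 c

variable (F) in
theorem t_mem_Puiseux : t F ∈ Puiseux F := by
  simpa [t] using single_mem_Puiseux (F := F) 1 1

variable (F) in
/-- The inclusion of the constants in `K`. -/
def constHom : F →+* Puiseux F :=
  (HahnSeries.C : F →+* Hahn F).codRestrict (Puiseux F) C_mem_Puiseux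

variable (F) in
theorem artinSchreier_iterate_s [CharP F p] [CharP (Hahn F) p] (l m : ℕ) :
    (artinSchreier p)^[l] (s p F (l + m)) = s p F m := by
  induction l generalizing m with
  | zero => simp
  | succ l ih =>
    rw [Function.iterate_succ_apply', add_right_comm, add_assoc, ih (m + 1)]
    exact s_succ_pow p F m

variable (F) in
theorem artinSchreier_iterate_succ_s [CharP F p] [CharP (Hahn F) p] (m : ℕ) :
    (artinSchreier p)^[m + 1] (s p F m) =
      algebraMap (Puiseux F) (Hahn F) (⟨t F, t_mem_Puiseux F⟩⁻¹) := by
  rw [Function.iterate_succ_apply']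
  have := artinSchreier_iterate_s p F m 0
  rw [add_zero] at this
  rw [this]
  exact s_zero_pow p F

variable (F) in
theorem natDegree_minpoly_s [IsAlgClosed F] [Algebra (ZMod p) F] [CharP F p]
    [CharP (Puiseux F) p] [CharP (Hahn F) p] (m : ℕ) :
    (minpoly (Puiseux F) (s p F m)).natDegree = p ^ (m + 1) := by
  refine natDegree_minpoly_of_artinSchreier_iterate (constHom F)
    (artinSchreier_iterate_succ_s p F m) fun g hg => ?_
  have hmem : ∑ l : Fin (m + 1), (HahnSeries.C (g l) : Hahn F) * s p F (m - l) ∈ Puiseux F := by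
    obtain ⟨b, hb⟩ := hg
    have h : ∑ l : Fin (m + 1), (HahnSeries.C (g l) : Hahn F) * s p F (m - l) = b := by
      refine Eq.trans (Finset.sum_congr rfl fun l _ => ?_) hb.symm
      have h1 := artinSchreier_iterate_s p F l (m - l)
      rw [Nat.add_sub_cancel' (Nat.lt_succ_iff.1 l.2)] at h1
      rw [h1]
      rfl
    rw [h]
    exact b.2
  -- The `l`-th iterate of `s_m` is `s_{m-l}`, so the order is reversed to match the independence
  -- statement.
  rw [← Equiv.sum_comp Fin.revPerm] at hmem
  have h2 : ∑ l : Fin (m + 1),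
      (HahnSeries.C (g (Fin.revPerm l)) : Hahn F) * s p F (m - (Fin.revPerm l : ℕ)) =
      ∑ l ∈ Finset.range (m + 1),
        (HahnSeries.C (g (Fin.rev (Fin.ofNat (m + 1) l))) : Hahn F) * s p F l := by
    rw [Finset.sum_range]
    refine Finset.sum_congr rfl fun l _ => ?_
    have h3 : m - (Fin.revPerm l : ℕ) = l := by
      rw [Fin.revPerm_apply, Fin.val_rev]
      omega
    rw [h3, Fin.ofNat_eq_cast, Fin.cast_val_eq_self, Fin.revPerm_apply]
  rw [h2] at hmem
  have h4 := eq_zero_of_sum_s_mem_Puiseux p (m + 1) _ hmem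
  funext l
  have h5 := h4 (Fin.rev l) (Fin.rev l).2
  rwa [Fin.ofNat_eq_cast, Fin.cast_val_eq_self, Fin.rev_rev] at h5

variable (F) in
theorem s_mem_adjoin [CharP F p] [CharP (Hahn F) p] {l m : ℕ} (h : l ≤ m) :
    s p F l ∈ IntermediateField.adjoin (Puiseux F) {s p F m} := by
  obtain ⟨k, rfl⟩ := Nat.exists_eq_add_of_le h
  induction k with
  | zero => exact IntermediateField.mem_adjoin_simple_self _ _
  | succ k ih =>
    have h1 : s p F (l + k) ∈ IntermediateField.adjoin (Puiseux F) {s p F (l + (k + 1))} := by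
      rw [← s_succ_pow p F (l + k)]
      have := IntermediateField.mem_adjoin_simple_self (Puiseux F) (s p F (l + k + 1))
      exact sub_mem (pow_mem this p) this
    exact IntermediateField.adjoin_simple_le_iff.2 h1 (ih (by omega))

variable (F) in
theorem t_mem (E : IntermediateField (Puiseux F) (Hahn F)) : t F ∈ E :=
  E.algebraMap_mem ⟨t F, t_mem_Puiseux F⟩

theorem C_mem (E : IntermediateField (Puiseux F) (Hahn F)) (c : F) : HahnSeries.C c ∈ E :=
  E.algebraMap_mem ⟨HahnSeries.C c, C_mem_Puiseux c⟩

variable (F) in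
theorem sDiag_mem_adjoin [CharP F p] [CharP (Hahn F) p] (m : ℕ) :
    sDiag p F (m + 1) ∈ IntermediateField.adjoin (Puiseux F) {s p F m} :=
  sum_mem fun _ hl => mul_mem (pow_mem (t_mem F _) _)
    (s_mem_adjoin p F (Nat.lt_succ_iff.1 (Finset.mem_range.1 hl)))

theorem deg_le_deg_of_mem_adjoin {x y : Hahn F} (hx : IsIntegral (Puiseux F) x)
    (hy : y ∈ IntermediateField.adjoin (Puiseux F) {x}) : deg y ≤ deg x := by
  have := IntermediateField.adjoin.finiteDimensional hx
  have hyi : IsIntegral (Puiseux F) y :=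
    (Algebra.IsIntegral.isIntegral (R := Puiseux F)
      (⟨y, hy⟩ : IntermediateField.adjoin (Puiseux F) {x})).map
      (IntermediateField.val _)
  rw [deg, deg, ← IntermediateField.adjoin.finrank hx, ← IntermediateField.adjoin.finrank hyi]
  exact IntermediateField.finrank_le_of_le_right (IntermediateField.adjoin_simple_le_iff.2 hy)

/-- Krasner-type step: an element at nonnegative distance from `s_i`, in an algebraic extension
of `K` containing the Artin-Schreier image of `s_i`, forces `s_i` into that extension. -/
theorem s_mem_of_le_v_sub [CharP (Hahn F) p] {E : IntermediateField (Puiseux F) (Hahn F)}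
    (hE : ∀ x ∈ E, IsIntegral (Puiseux F) x) {y : Hahn F} {i : ℕ} (hy : y ∈ E)
    (hs : s p F i ^ p - s p F i ∈ E) (hv : ((0 : ℚ) : WithTop ℚ) ≤ v (y - s p F i)) :
    s p F i ∈ E := by
  -- Subtracting the constant term makes the valuation of the error strictly positive, as Hensel's
  -- lemma needs.
  set c := (y - s p F i).coeff 0 with hc
  set w := y - s p F i - HahnSeries.C c with hw
  have hyC : y - HahnSeries.C c ∈ E := sub_mem hy (C_mem E c)
  have hwE : w ^ p - w ∈ E := by
    have : w ^ p - w = ((y - HahnSeries.C c) ^ p - (y - HahnSeries.C c)) -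
        (s p F i ^ p - s p F i) := by
      rw [hw, sub_right_comm, sub_pow_char]
      ring
    rw [this]
    exact sub_mem (sub_mem (pow_mem hyC p) hyC) hs
  have hvw : 0 < v w := by
    have hC : ((0 : ℚ) : WithTop ℚ) ≤ v (HahnSeries.C c : Hahn F) := HahnSeries.orderTop_single_le
    have h0 : ((0 : ℚ) : WithTop ℚ) ≤ v w := le_v_sub hv hC
    refine lt_of_le_of_ne (by exact_mod_cast h0) fun h => ?_
    have hcoeff : w.coeff 0 = 0 := by
      rw [hw, HahnSeries.coeff_sub, ← hc]
      simp
    exact HahnSeries.orderTop_ne_of_coeff_eq_zero hcoeff h.symm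
  have hmem := mem_of_pow_sub_mem E hvw hwE (hE _ hwE)
  have : s p F i = y - HahnSeries.C c - w := by
    rw [hw]
    ring
  rw [this]
  exact sub_mem hyC hmem

variable (F) in
theorem t_ne_zero : t F ≠ 0 := HahnSeries.single_ne_zero one_ne_zero

variable (F) in
theorem v_t_pow (k : ℕ) : v (t F ^ k) = ((k : ℚ) : WithTop ℚ) := by
  rw [t, HahnSeries.single_pow, one_pow, v, HahnSeries.orderTop_single one_ne_zero]
  simp

variable (F) in
theorem le_v_t_pow_mul_s (k m : ℕ) : ((k : ℚ) : WithTop ℚ) ≤ v (t F ^ (k + 1) * s p F m) := by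
  refine le_trans ?_ (le_v_mul (v_t_pow F (k + 1)).ge (le_v_s p F m))
  have hp1 : (1 : ℚ) ≤ p := by exact_mod_cast hp.out.one_lt.le
  have h1 : (-1 : ℚ) ≤ -1 / p := by
    rw [le_div_iff₀ (by linarith)]
    linarith
  have h2 : (k : ℚ) ≤ ((k + 1 : ℕ) : ℚ) + -1 / p := by
    push_cast
    linarith
  exact_mod_cast h2

/-- The series `s_0, …, s_{n-1}` lie in `K(u)` for every `u` with truncation `s_{n,n}`. -/
theorem s_mem_adjoin_of_mem_ball [CharP F p] [CharP (Hahn F) p] {n : ℕ} {u : Hahn F}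
    (hu : u ∈ ball ((n : ℚ) - 1) (sDiag p F n)) {i : ℕ} (hi : i < n) :
    s p F i ∈ IntermediateField.adjoin (Puiseux F) {u} := by
  have huint : IsIntegral (Puiseux F) u := (mem_algebraicClosure_iff.1 hu.1).isIntegral
  have := IntermediateField.adjoin.finiteDimensional huint
  set E := IntermediateField.adjoin (Puiseux F) {u} with hE
  have hEint : ∀ x ∈ E, IsIntegral (Puiseux F) x := fun x hx =>
    (Algebra.IsIntegral.isIntegral (R := Puiseux F) (⟨x, hx⟩ : E)).map (IntermediateField.val _)
  induction i using Nat.strong_induction_on with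
  | _ i ih =>
    have ht0 := pow_ne_zero i (t_ne_zero F)
    -- By induction `y` lies in `K(u)`; it equals `s_i` up to an error of valuation at least `0`.
    set y := (t F ^ i)⁻¹ * (u - ∑ m ∈ Finset.range i, t F ^ m * s p F m) with hy
    have hyE : y ∈ E := by
      refine mul_mem (inv_mem (pow_mem (t_mem F E) i)) (sub_mem ?_ (sum_mem fun m hm => ?_))
      · exact IntermediateField.mem_adjoin_simple_self _ _
      · have := Finset.mem_range.1 hm
        exact mul_mem (pow_mem (t_mem F E) m) (ih m this (by omega))
    refine s_mem_of_le_v_sub p hEint hyE ?_ ?_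
    · rcases i with _ | i
      · rw [s_zero_pow]
        exact inv_mem (t_mem F E)
      · rw [s_succ_pow]
        exact ih i (by omega) (by omega)
    · have hsum : ((i : ℚ) : WithTop ℚ) ≤ v (t F ^ i * (y - s p F i)) := by
        have heq : t F ^ i * (y - s p F i) =
            (u - sDiag p F n) + ∑ m ∈ Finset.Ico (i + 1) n, t F ^ m * s p F m := by
          have h1 : sDiag p F n = ∑ m ∈ Finset.range i, t F ^ m * s p F m + t F ^ i * s p F i +
              ∑ m ∈ Finset.Ico (i + 1) n, t F ^ m * s p F m := by
            rw [← Finset.sum_range_succ, Finset.sum_range_add_sum_Ico _ (by omega : i + 1 ≤ n)]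
            rfl
          rw [h1, hy, mul_sub, mul_inv_cancel_left₀ ht0]
          ring
        rw [heq]
        -- The radius `n - 1 ≥ i` bounds the first summand; later terms satisfy `v (t ^ m s_m) ≥ m -
        -- 1/p ≥ i`.
        refine le_v_add (le_trans ?_ hu.2) (le_v_sum fun m hm => ?_)
        · have : (i : ℚ) + 1 ≤ n := by exact_mod_cast hi
          have : (i : ℚ) ≤ n - 1 := by linarith
          exact_mod_cast this
        · obtain ⟨h1, -⟩ := Finset.mem_Ico.1 hm
          obtain ⟨k, rfl⟩ := Nat.exists_eq_add_of_le' (by omega : 1 ≤ m)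
          refine le_trans ?_ (le_v_t_pow_mul_s p F k (k + 1))
          have : (i : ℚ) ≤ k := by exact_mod_cast (by omega : i ≤ k)
          exact_mod_cast this
      rw [v_mul, v_t_pow] at hsum
      by_cases hz : y - s p F i = 0
      · rw [hz, v_zero]
        exact le_top
      obtain ⟨G, hG⟩ := exists_v_eq hz
      rw [hG] at hsum ⊢
      have h1 : (i : ℚ) ≤ i + G := by exact_mod_cast hsum
      have : 0 ≤ G := by linarith
      exact_mod_cast this

theorem degSet_ball_sDiag [Algebra (ZMod p) F] [IsAlgClosure (ZMod p) F] {n : ℕ} (hn : 1 ≤ n) :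
    sDiag p F n ∈ Kbar F ∧
    (∀ u ∈ ball ((n : ℚ) - 1) (sDiag p F n), p ^ n ≤ deg u) ∧
    degSet (ball ((n : ℚ) - 1) (sDiag p F n)) = p ^ n := by
  have : IsAlgClosed F := IsAlgClosure.isAlgClosed (ZMod p)
  have : CharP F p := charP_of_injective_algebraMap (algebraMap (ZMod p) F).injective p
  have : CharP (Puiseux F) p := charP_of_injective_ringHom (constHom F).injective p
  have : CharP (Hahn F) p :=
    charP_of_injective_algebraMap (algebraMap (Puiseux F) (Hahn F)).injective p
  obtain ⟨m, rfl⟩ := Nat.exists_eq_add_of_le' hn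
  have hs : IsIntegral (Puiseux F) (s p F m) :=
    isIntegral_of_artinSchreier_iterate (artinSchreier_iterate_succ_s p F m)
  have hdeg : deg (s p F m) = p ^ (m + 1) := natDegree_minpoly_s p F m
  have hmem : sDiag p F (m + 1) ∈ Kbar F := by
    have hle : IntermediateField.adjoin (Puiseux F) {s p F m} ≤ Kbar F :=
      IntermediateField.adjoin_simple_le_iff.2 (mem_algebraicClosure_iff.2 hs.isAlgebraic)
    exact hle (sDiag_mem_adjoin p F m)
  have hlow : ∀ u ∈ ball (((m + 1 : ℕ) : ℚ) - 1) (sDiag p F (m + 1)), p ^ (m + 1) ≤ deg u := by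
    intro u hu
    rw [← hdeg]
    exact deg_le_deg_of_mem_adjoin (mem_algebraicClosure_iff.1 hu.1).isIntegral
      (s_mem_adjoin_of_mem_ball p hu (Nat.lt_succ_self m))
  have hself : sDiag p F (m + 1) ∈ ball (((m + 1 : ℕ) : ℚ) - 1) (sDiag p F (m + 1)) := by
    refine ⟨hmem, ?_⟩
    rw [sub_self, v_zero]
    exact le_top
  refine ⟨hmem, hlow, le_antisymm ?_ ?_⟩
  · refine (Nat.sInf_le (Set.mem_image_of_mem deg hself)).trans ?_
    rw [← hdeg]
    exact deg_le_deg_of_mem_adjoin hs (sDiag_mem_adjoin p F m)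
  -- Nonemptiness of the ball matters: `sInf ∅ = 0` in `ℕ`.
  · obtain ⟨u, hu, hd⟩ := Nat.sInf_mem ((Set.nonempty_of_mem hself).image deg)
    rw [degSet, ← hd]
    exact hlow u hu

end Degree

end HahnTower

end

theorem mainTheorem4 (p : ℕ) [Fact p.Prime] (F : Type*) [Field F] [Algebra (ZMod p) F]
    [IsAlgClosure (ZMod p) F] (n : ℕ) (hn : 1 ≤ n) :
    HahnTower.sDiag p F n ∈ HahnTower.Kbar F ∧
    (∀ u ∈ HahnTower.ball ((n : ℚ) - 1) (HahnTower.sDiag p F n), p ^ n ≤ HahnTower.deg u) ∧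
    HahnTower.degSet (HahnTower.ball ((n : ℚ) - 1) (HahnTower.sDiag p F n)) = p ^ n := by
  exact HahnTower.degSet_ball_sDiag p hn
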